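/- Let $F=(x,y):\mathbb R\to\mathbb R^2$ be a simple closed convex front track of class $C^1$, parametrized by arc length, of perimeter $L$, i.e. $|\dot F|=1$, $F(t+L)=F(t)$, and $F$ maps $[0,L)$ bijectively onto the boundary of a compact convex set $K\subset\mathbb R^2$ with non-empty interior. Let $A$ be the area of $K$, and let $\sigma=1$ if $F$ traverses $\partial K$ counterclockwise and $\sigma=-1$ if clockwise. For $\ell>0$ let $g_\ell$ be the fundamental solution of the bicycle equation with bicycle length $\ell$: $$\dot g_\ell(t)=a_\ell(t)\,g_\ell(t),\qquad g_\ell(0)=I,\qquad a_\ell=-\frac1{2\ell}\begin{pmatrix}\dot x&\dot y\\ \dot y&-\dot x\end{pmatrix}.$$ Identify $\mathfrak{sl}_2(\mathbb R)$ with Minkowski space $\mathbb R^{2,1}$ by writing $a=\frac12\begin{pmatrix}a_1&a_2+a_3\\a_2-a_3&-a_1\end{pmatrix}$, with the inner product $\langle a,b\rangle=2\operatorname{tr}(ab)=a_1b_1+a_2b_2-a_3b_3$, and let $\mathrm{Ad}_g(a)=gag^{-1}$. Then for all sufficiently large $\ell$ the map $\mathrm{Ad}_{g_\ell(L)}$ is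 a nontrivial elliptic rotation of $\mathbb R^{2,1}$ around a timelike axis. That is, there are a vector $v_\ell$ with $\langle v_\ell,v_\ell\rangle=-1$ and positive $a_3$-coordinate, and an angle $\varphi_\ell\notin2\pi\mathbb Z$, such that $\mathrm{Ad}_{g_\ell(L)}$ fixes $v_\ell$ and rotates the spacelike plane $v_\ell^\perp$ through the angle $\varphi_\ell$, where the plane is oriented so that a positively oriented basis of it followed by $v_\ell$ is positively oriented with respect to $a_1\wedge a_2\wedge a_3$. Moreover, as $\ell\to\infty$ with $F$ fixed, $$\varphi_\ell=\sigma\,\ell^{-2}A+O(\ell^{-3}),$$ and the axis $\mathbb R v_\ell$ is $O(\ell^{-1})$-close to the $a_3$-axis: $\|v_\ell-\mathbf k\|=O(\ell^{-1})$, where $\mathbf k$ has coordinates $(a_1,a_2,a_3)=(0,0,1)$ and $\|\cdot\|$ is the Euclidean norm in these coordinates. -/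

import Mathlib

open Set Filter Topology MeasureTheory

noncomputable section

namespace Bicycle

/-- The Euclidean plane. -/
abbrev Plane : Type := EuclideanSpace ℝ (Fin 2)

/-- The Lie algebra of traceless real `2 × 2` matrices. -/
abbrev Sl2 : Type := ↥(LieAlgebra.SpecialLinear.sl (Fin 2) ℝ)

/-! ### Closed convex curves -/

/-- `F` is a closed convex curve of perimeter `L`, parametrized by arc length (and extended
periodically), bounding the convex body `K`: it is simple, of class `C¹`, has unit speed, and its
trace is the boundary of the planar convex body `K`. -/
structure IsClosedConvexCurve (F : ℝ → Plane) (L : ℝ) (K : ConvexBody Plane) : Prop where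
  contDiff : ContDiff ℝ 1 F
  length_pos : 0 < L
  periodic : Function.Periodic F L
  unit_speed : ∀ t, ‖deriv F t‖ = 1
  simple : InjOn F (Ico 0 L)
  interior_nonempty : (interior (K : Set Plane)).Nonempty
  range_eq : range F = frontier (K : Set Plane)

/-- The area of a planar convex body, i.e. its two-dimensional Lebesgue measure. -/
def area (K : ConvexBody Plane) : ℝ := (volume : Measure Plane).real (K : Set Plane)

/-- `F` runs around `K` counterclockwise: `K` lies to the left of each oriented tangent line. -/
def IsCounterclockwise (F : ℝ → Plane) (K : ConvexBody Plane) : Prop :=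
  ∀ t : ℝ, ∀ p ∈ (K : Set Plane),
    0 ≤ deriv F t 0 * (p 1 - F t 1) - deriv F t 1 * (p 0 - F t 0)

open Classical in
/-- The orientation sign: `1` for counterclockwise and `-1` for clockwise traversal. -/
def orientationSign (F : ℝ → Plane) (K : ConvexBody Plane) : ℝ :=
  if IsCounterclockwise F K then 1 else -1

/-! ### The bicycle equation -/

/-- The coefficient matrix of the bicycle equation with front track `F = (x, y)` and bicycle
length `ℓ`. -/
def bicycleMatrix (F : ℝ → Plane) (ℓ t : ℝ) : Matrix (Fin 2) (Fin 2) ℝ :=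
  (-(1 / (2 * ℓ))) • !![deriv F t 0, deriv F t 1; deriv F t 1, -deriv F t 0]

/-- `g` is the fundamental solution of `x' = a(t) x`: `g' = a g` and `g(0)` is the identity. -/
def IsFundamentalSolution (a g : ℝ → Matrix (Fin 2) (Fin 2) ℝ) : Prop :=
  (∀ t i j, HasDerivAt (fun s => g s i j) ((a t * g t) i j) t) ∧ g 0 = 1

/-! ### The Minkowski space `sl₂(ℝ)` -/

/-- The adjoint action `a ↦ g a g⁻¹` on traceless matrices. (If `g` is singular, then `g⁻¹ = 0`
by convention; fundamental solutions are never singular.) -/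
def Ad (g : Matrix (Fin 2) (Fin 2) ℝ) : Sl2 →ₗ[ℝ] Sl2 where
  toFun a := ⟨g * (a : Matrix (Fin 2) (Fin 2) ℝ) * g⁻¹, by
    have ha : (a : Matrix (Fin 2) (Fin 2) ℝ).trace = 0 := LinearMap.mem_ker.1 a.2
    refine LinearMap.mem_ker.2 ?_
    rw [Matrix.traceLinearMap_apply, Matrix.trace_mul_comm, ← Matrix.mul_assoc]
    by_cases h : IsUnit g.det
    · rw [Matrix.nonsing_inv_mul _ h, Matrix.one_mul, ha]
    · rw [Matrix.nonsing_inv_apply_not_isUnit _ h]; simp⟩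
  map_add' a b := by
    apply Subtype.ext
    simp [Matrix.mul_add, Matrix.add_mul]
  map_smul' c a := by
    apply Subtype.ext
    simp

/-- The inner product `⟨a, b⟩ = 2 tr(ab)`, of signature `(+, +, -)`. -/
def mink (a b : Sl2) : ℝ :=
  2 * ((a : Matrix (Fin 2) (Fin 2) ℝ) * (b : Matrix (Fin 2) (Fin 2) ℝ)).trace

/-- The linear coordinates `(a₁, a₂, a₃)` on `sl₂(ℝ)`, defined by
`a = (1/2) !![a₁, a₂ + a₃; a₂ - a₃, -a₁]`; in them `⟨a, b⟩ = a₁ b₁ + a₂ b₂ - a₃ b₃`. -/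
def coords (a : Sl2) : EuclideanSpace ℝ (Fin 3) :=
  !₂[2 * a.1 0 0, a.1 0 1 + a.1 1 0, a.1 0 1 - a.1 1 0]

/-- `T` is the elliptic Minkowski rotation through the angle `φ` around the timelike axis spanned
by the future pointing unit vector `v`: it fixes `v`, and in the spacelike plane orthogonal to `v`
it is the rotation through the angle `φ`, not a multiple of `2π`. The plane is oriented by
orthonormal bases `e₁, e₂` for which `e₁, e₂, v` is positively oriented with respect to the
volume form `a₁ ∧ a₂ ∧ a₃`. -/
def IsEllipticRotation (T : Sl2 →ₗ[ℝ] Sl2) (v : Sl2) (φ : ℝ) : Prop :=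
  mink v v = -1 ∧ 0 < coords v 2 ∧ T v = v ∧ Real.cos φ ≠ 1 ∧
    ∃ e₁ e₂ : Sl2,
      mink e₁ e₁ = 1 ∧ mink e₂ e₂ = 1 ∧ mink e₁ e₂ = 0 ∧ mink e₁ v = 0 ∧ mink e₂ v = 0 ∧
      0 < Matrix.det !![coords e₁ 0, coords e₁ 1, coords e₁ 2;
                        coords e₂ 0, coords e₂ 1, coords e₂ 2;
                        coords v 0, coords v 1, coords v 2] ∧
      T e₁ = Real.cos φ • e₁ + Real.sin φ • e₂ ∧
      T e₂ = -Real.sin φ • e₁ + Real.cos φ • e₂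

end Bicycle

end

open Set Filter Topology MeasureTheory

namespace Bicycle


/-! Put `ε = 1 / ℓ`, view the plane as `ℂ`, and let `Φ` be the front track. A column `z` of the
fundamental solution satisfies `z' = -(ε/2) Φ' conj z`. Two Picard steps suffice: the first-order
term integrates `Φ'` over a closed curve and vanishes; the second-order term is `(ε²/4) (∫ Φ' conj
Φ) z(0)`. The real part of `Φ' conj Φ` is the derivative of `|Φ|²/2`, its imaginary part is `x y' -
y x'`, so the integral is `2 i σ A`. Thus the monodromy is `1 + (σ A ε²/2) J + O(ε³)` with `J` the
quarter turn (`norm_monodromy_sub_le`, `IsClosedConvexCurve.integral_cross`).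

An elliptic `M` of determinant 1 has the form `cos (φ/2) - sin (φ/2) u` with `u² = -1`; conjugation
by it rotates about `u` through twice the half angle. Angle and axis are explicit in the entries of
`M` through `√(4 - tr² M)`. Its main term `A ε²` is small, so `discriminant_estimate` has to exploit
`det M = 1`. -/

/-! ### Area of a convex body as a line integral along its boundary -/

theorem eq_of_smul_eq_smul_frontier {E : Type*} [AddCommGroup E] [Module ℝ E] [TopologicalSpace E]
    [IsTopologicalAddGroup E] [ContinuousSMul ℝ E] {K : Set E} (hc : Convex ℝ K)
    (h0 : (0 : E) ∈ interior K) {s t : ℝ} (hs : 0 < s) (ht : 0 < t) {p q : E}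
    (hp : p ∈ frontier K) (hq : q ∈ frontier K) (h : s • p = t • q) : s = t ∧ p = q := by
  have hK : K ∈ 𝓝 (0 : E) := mem_interior_iff_mem_nhds.1 h0
  have hp' := (gauge_eq_one_iff_mem_frontier hc hK).2 hp
  have hq' := (gauge_eq_one_iff_mem_frontier hc hK).2 hq
  have hst : s = t := by
    have := congrArg (gauge K) h
    rwa [gauge_smul_of_nonneg hs.le, gauge_smul_of_nonneg ht.le, hp', hq', smul_eq_mul,
      smul_eq_mul, mul_one, mul_one] at this
  subst hst
  exact ⟨rfl, smul_right_injective E hs.ne' h⟩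

/-- The gauge is the radial coordinate: it is 1 on the frontier, less than 1 inside, and by
boundedness vanishes only at the origin. -/
theorem image_smul_frontier {E : Type*} [NormedAddCommGroup E] [NormedSpace ℝ E]
    {K : Set E} (hc : Convex ℝ K) (hb : Bornology.IsBounded K)
    (h0 : (0 : E) ∈ interior K) {α : Type*} {γ : α → E} {A : Set α} (hγ : γ '' A = frontier K) :
    (fun p : ℝ × α => p.1 • γ p.2) '' (Ioo 0 1 ×ˢ A) = interior K \ {0} := by
  have hK : K ∈ 𝓝 (0 : E) := mem_interior_iff_mem_nhds.1 h0
  have habs : Absorbent ℝ K := absorbent_nhds_zero hK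
  have hvn : Bornology.IsVonNBounded ℝ K := (NormedSpace.isVonNBounded_iff ℝ).2 hb
  ext p
  constructor
  · rintro ⟨⟨s, t⟩, ⟨⟨hs0, hs1⟩, ht⟩, rfl⟩
    have hf : γ t ∈ frontier K := hγ ▸ mem_image_of_mem γ ht
    have hg := (gauge_eq_one_iff_mem_frontier hc hK).2 hf
    have hgs : gauge K (s • γ t) = s := by
      rw [gauge_smul_of_nonneg hs0.le, hg, smul_eq_mul, mul_one]
    refine ⟨(gauge_lt_one_iff_mem_interior hc hK).1 (by simpa [hgs] using hs1), fun h => ?_⟩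
    rw [mem_singleton_iff] at h
    simp only at h
    rw [h, gauge_zero] at hgs
    exact hs0.ne hgs
  · rintro ⟨hp, hp0⟩
    have h1 := (gauge_lt_one_iff_mem_interior hc hK).2 hp
    have h2 : 0 < gauge K p := (gauge_pos habs hvn).2 hp0
    have hf : (gauge K p)⁻¹ • p ∈ frontier K := by
      rw [← gauge_eq_one_iff_mem_frontier hc hK, gauge_smul_of_nonneg (inv_nonneg.2 h2.le),
        smul_eq_mul, inv_mul_cancel₀ h2.ne']
    rw [← hγ] at hf
    obtain ⟨t, ht, hte⟩ := hf
    exact ⟨(gauge K p, t), ⟨⟨h2, h1⟩, ht⟩, by simp [hte, smul_smul, mul_inv_cancel₀ h2.ne']⟩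

/-- Change of variables along `(s, t) ↦ s γ(t)`, whose Jacobian is `s (x y' - y x')`; the factor 1/2
is `∫ s` over `(0, 1)`. The frontier of a convex set is null, so the interior suffices. -/
theorem volume_real_eq_integral_abs_cross {K : Set (ℝ × ℝ)} (hc : Convex ℝ K) (hK : IsCompact K)
    (h0 : (0 : ℝ × ℝ) ∈ interior K) {x y x' y' : ℝ → ℝ} {L : ℝ} (hL : 0 ≤ L)
    (hx : ∀ t, HasDerivAt x (x' t) t) (hy : ∀ t, HasDerivAt y (y' t) t)
    (hinj : InjOn (fun t => (x t, y t)) (Ico 0 L))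
    (himg : (fun t => (x t, y t)) '' Ico 0 L = frontier K) :
    (volume : Measure (ℝ × ℝ)).real K = 1 / 2 * ∫ t in 0..L, |x t * y' t - y t * x' t| := by
  set f : ℝ × ℝ → ℝ × ℝ := fun p => p.1 • (x p.2, y p.2) with hf
  set f' : ℝ × ℝ → ℝ × ℝ →L[ℝ] ℝ × ℝ := fun p =>
    LinearMap.toContinuousLinearMap (Matrix.toLin (Module.Basis.finTwoProd ℝ)
      (Module.Basis.finTwoProd ℝ) !![x p.2, p.1 * x' p.2; y p.2, p.1 * y' p.2]) with hf'
  have hdet : ∀ p, (f' p).det = p.1 * (x p.2 * y' p.2 - y p.2 * x' p.2) := by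
    intro p
    simp only [hf', LinearMap.det_toContinuousLinearMap, LinearMap.det_toLin, Matrix.det_fin_two_of]
    ring
  have hder : ∀ p, HasFDerivAt f (f' p) p := by
    intro p
    simp only [hf', Matrix.toLin_finTwoProd_toContinuousLinearMap]
    have h2 : HasFDerivAt (fun p : ℝ × ℝ => p.2) (ContinuousLinearMap.snd ℝ ℝ ℝ) p := hasFDerivAt_snd
    have hx2 : HasFDerivAt (fun p : ℝ × ℝ => x p.2) _ p := (hx p.2).comp_hasFDerivAt p h2
    have hy2 : HasFDerivAt (fun p : ℝ × ℝ => y p.2) _ p := (hy p.2).comp_hasFDerivAt p h2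
    have h1 : HasFDerivAt (fun p : ℝ × ℝ => p.1) (ContinuousLinearMap.fst ℝ ℝ ℝ) p := hasFDerivAt_fst
    have h3 : HasFDerivAt f _ p := (h1.mul hx2).prodMk (h1.mul hy2)
    refine h3.congr_fderiv ?_
    ext <;> simp
  have hfi : f '' (Ioo 0 1 ×ˢ Ico 0 L) = interior K \ {0} :=
    image_smul_frontier hc hK.isBounded h0 himg
  have hfinj : InjOn f (Ioo 0 1 ×ˢ Ico 0 L) := by
    rintro ⟨s, t⟩ ⟨hs, ht⟩ ⟨s', t'⟩ ⟨hs', ht'⟩ h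
    obtain ⟨h1, h2⟩ := eq_of_smul_eq_smul_frontier hc h0 hs.1 hs'.1
      (himg ▸ mem_image_of_mem _ ht) (himg ▸ mem_image_of_mem _ ht') h
    exact Prod.ext h1 (hinj ht ht' h2)
  have hcv := integral_image_eq_integral_abs_det_fderiv_smul volume
    (measurableSet_Ioo.prod measurableSet_Ico) (fun p _ => (hder p).hasFDerivWithinAt) hfinj
    (fun _ => (1 : ℝ))
  have hvol : (volume : Measure (ℝ × ℝ)).real (interior K \ {0}) = volume.real K := by
    apply measureReal_congr
    exact (sdiff_null_ae_eq_self (measure_singleton _)).trans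
      (interior_ae_eq_of_null_frontier (hc.addHaar_frontier volume))
  rw [hfi, setIntegral_const, smul_eq_mul, mul_one, hvol] at hcv
  rw [hcv]
  have : EqOn (fun p : ℝ × ℝ => |(f' p).det| • (1 : ℝ))
      (fun p => p.1 * |x p.2 * y' p.2 - y p.2 * x' p.2|) (Ioo 0 1 ×ˢ Ico 0 L) := by
    rintro p ⟨hp, -⟩
    simp [hdet, abs_mul, abs_of_pos hp.1]
  rw [setIntegral_congr_fun (measurableSet_Ioo.prod measurableSet_Ico) this, Measure.volume_eq_prod,
    setIntegral_prod_mul (fun s => s) (fun t => |x t * y' t - y t * x' t|),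
    integral_Ico_eq_integral_Ioc, ← intervalIntegral.integral_of_le hL,
    ← integral_Ioc_eq_integral_Ioo, ← intervalIntegral.integral_of_le zero_le_one, integral_id]
  norm_num

/-- A supporting functional at the boundary point is maximal there along the curve, so it kills the
velocity; it is positive at that point because the origin is interior. Hence the tangent line is the
support line and misses the origin. -/
theorem cross_deriv_of_range_subset_frontier {K : Set (ℝ × ℝ)} (hc : Convex ℝ K)
    (hK : IsClosed K) (h0 : (0 : ℝ × ℝ) ∈ interior K) {x y x' y' : ℝ → ℝ}
    (hx : ∀ t, HasDerivAt x (x' t) t) (hy : ∀ t, HasDerivAt y (y' t) t)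
    (hF : ∀ t, (x t, y t) ∈ frontier K) (t : ℝ) (hne : x' t ^ 2 + y' t ^ 2 = 1) :
    x t * y' t - y t * x' t ≠ 0 ∧ ∀ p ∈ K,
      0 ≤ (x t * y' t - y t * x' t) * (x' t * (p.2 - y t) - y' t * (p.1 - x t)) := by
  obtain ⟨f, hf⟩ := geometric_hahn_banach_open_point hc.interior isOpen_interior (hF t).2
  have hcoord : ∀ p : ℝ × ℝ, f p = f (1, 0) * p.1 + f (0, 1) * p.2 := by
    rintro ⟨a, b⟩
    have : ((a, b) : ℝ × ℝ) = a • (1, 0) + b • (0, 1) := by simp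
    rw [this, map_add, map_smul, map_smul]
    simp [mul_comm]
  have hle : ∀ p ∈ K, f p ≤ f (x t, y t) := by
    have : closure (interior K) ⊆ {p | f p ≤ f (x t, y t)} :=
      closure_minimal (fun p hp => (hf p hp).le) (isClosed_le f.continuous continuous_const)
    rw [hc.closure_interior_eq_closure_of_nonempty_interior ⟨0, h0⟩] at this
    exact fun p hp => this (subset_closure hp)
  generalize f (1, 0) = α at hcoord
  generalize f (0, 1) = β at hcoord
  have hpos : 0 < α * x t + β * y t := by simpa [hcoord] using hf 0 h0
  have hder : α * x' t + β * y' t = 0 := by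
    refine IsLocalMax.hasDerivAt_eq_zero (f := fun s => α * x s + β * y s) (a := t)
      (Eventually.of_forall fun s => ?_) (((hx t).const_mul α).add ((hy t).const_mul β))
    simpa [hcoord] using hle _ (hK.frontier_subset (hF s))
  -- With `e2`: the velocity is a multiple of `(-β, α)`, the direction of the support line, with
  -- factor proportional to the cross product.
  have e1 : (α * x t + β * y t) * x' t = -β * (x t * y' t - y t * x' t) := by
    linear_combination x t * hder
  have e2 : (α * x t + β * y t) * y' t = α * (x t * y' t - y t * x' t) := by
    linear_combination y t * hder
  constructor
  · intro hD
    rw [hD, mul_zero] at e1 e2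
    rw [(mul_eq_zero.1 e1).resolve_left hpos.ne', (mul_eq_zero.1 e2).resolve_left hpos.ne'] at hne
    norm_num at hne
  · intro p hp
    have h := hle p hp
    rw [hcoord, hcoord] at h
    simp only at h
    refine nonneg_of_mul_nonneg_right (a := α * x t + β * y t) ?_ hpos
    have : (α * x t + β * y t) * ((x t * y' t - y t * x' t) *
        (x' t * (p.2 - y t) - y' t * (p.1 - x t))) = (x t * y' t - y t * x' t) ^ 2 *
        (α * x t + β * y t - (α * p.1 + β * p.2)) := by
      linear_combination (x t * y' t - y t * x' t) * ((p.2 - y t) * e1 - (p.1 - x t) * e2)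
    rw [this]
    exact mul_nonneg (sq_nonneg _) (by linarith)

/-- The area enclosed by a closed convex curve as a line integral. -/
theorem IsClosedConvexCurve.integral_cross {F : ℝ → Plane} {L : ℝ} {K : ConvexBody Plane}
    (hF : IsClosedConvexCurve F L K) :
    ∃ c : Plane, ∫ t in 0..L, ((F t 0 - c 0) * deriv F t 1 - (F t 1 - c 1) * deriv F t 0) =
      2 * (orientationSign F K * area K) := by
  obtain ⟨c, hc⟩ := hF.interior_nonempty
  refine ⟨c, ?_⟩
  have hdF : ∀ t, HasDerivAt F (deriv F t) t := fun t =>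
    (hF.contDiff.differentiable one_ne_zero t).hasDerivAt
  have hdi : ∀ i t, HasDerivAt (fun s => F s i) (deriv F t i) t := fun i t =>
    ((EuclideanSpace.proj i : Plane →L[ℝ] ℝ).hasFDerivAt.comp_hasDerivAt t (hdF t))
  have hcd : Continuous (deriv F) := hF.contDiff.continuous_deriv le_rfl
  set T : Plane ≃L[ℝ] ℝ × ℝ :=
    (EuclideanSpace.equiv (Fin 2) ℝ).trans (ContinuousLinearEquiv.finTwoArrow ℝ ℝ)
  have hT : ∀ p, T p = (p 0, p 1) := fun p => rfl
  set H : Plane ≃ₜ ℝ × ℝ := T.toHomeomorph.trans (Homeomorph.addLeft (-(T c)))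
  have hH : ∀ p, H p = (p 0 - c 0, p 1 - c 1) := fun p => by
    show -(T c) + T p = _
    rw [hT, hT, neg_add_eq_sub, Prod.mk_sub_mk]
  have hHm : MeasurePreserving H.toMeasurableEquiv (volume : Measure Plane) volume := by
    have h1 := (volume_preserving_finTwoArrow ℝ).comp
      (EuclideanSpace.volume_preserving_symm_measurableEquiv_toLp (Fin 2))
    exact (measurePreserving_add_left volume (-(T c))).comp h1
  set K' : Set (ℝ × ℝ) := H '' K with hK'
  have hvol : (volume : Measure (ℝ × ℝ)).real K' = area K := by
    have := hHm.measure_preimage_equiv K'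
    rw [area, Measure.real, Measure.real, ← this]
    congr 2
    exact preimage_image_eq _ H.injective
  have hconv : Convex ℝ K' := by
    have := (K.convex.linear_image T.toLinearMap).translate (-(T c))
    rwa [image_image] at this
  have hcomp : IsCompact K' := K.isCompact.image H.continuous
  have h0 : (0 : ℝ × ℝ) ∈ interior K' := by
    rw [hK', ← H.image_interior]
    exact ⟨c, hc, by rw [hH]; simp⟩
  have hfr : (fun t => (F t 0 - c 0, F t 1 - c 1)) = fun t => H (F t) := by
    funext t; rw [hH]
  have hfrange : ∀ t, (F t 0 - c 0, F t 1 - c 1) ∈ frontier K' := by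
    intro t
    rw [hK', ← H.image_frontier, ← hF.range_eq, ← hH]
    exact ⟨_, mem_range_self t, rfl⟩
  have himg : (fun t => (F t 0 - c 0, F t 1 - c 1)) '' Ico 0 L = frontier K' := by
    rw [hK', ← H.image_frontier, ← hF.range_eq, hfr, ← image_image H F]
    congr 1
    refine Subset.antisymm (image_subset_range _ _) ?_
    rintro _ ⟨t, rfl⟩
    obtain ⟨s, hs, hst⟩ := hF.periodic.exists_mem_Ico₀ hF.length_pos t
    exact ⟨s, hs, hst.symm⟩
  have hinj : InjOn (fun t => (F t 0 - c 0, F t 1 - c 1)) (Ico 0 L) := by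
    rw [hfr]
    exact H.injective.comp_injOn hF.simple
  have hx : ∀ t, HasDerivAt (fun s => F s 0 - c 0) (deriv F t 0) t := fun t =>
    (hdi 0 t).sub_const _
  have hy : ∀ t, HasDerivAt (fun s => F s 1 - c 1) (deriv F t 1) t := fun t =>
    (hdi 1 t).sub_const _
  have harea := volume_real_eq_integral_abs_cross hconv hcomp h0 hF.length_pos.le hx hy hinj himg
  rw [hvol] at harea
  have hspeed : ∀ t, deriv F t 0 ^ 2 + deriv F t 1 ^ 2 = 1 := fun t => by
    have := hF.unit_speed t
    rw [EuclideanSpace.norm_eq, Real.sqrt_eq_one] at this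
    simpa [Fin.sum_univ_two] using this
  have key := fun t =>
    cross_deriv_of_range_subset_frontier hconv hcomp.isClosed h0 hx hy hfrange t (hspeed t)
  set D : ℝ → ℝ := fun t => (F t 0 - c 0) * deriv F t 1 - (F t 1 - c 1) * deriv F t 0 with hD
  change area K = 1 / 2 * ∫ t in 0..L, |D t| at harea
  change ∫ t in 0..L, D t = _
  have hDc : Continuous D := by
    have := hF.contDiff.continuous
    fun_prop
  -- `D` is continuous without zeros, so the absolute value in the area formula is a global sign,
  -- matched below with the orientation.
  have hsign : (∀ t, 0 < D t) ∨ ∀ t, D t < 0 := by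
    by_contra! hcon
    obtain ⟨⟨s, hs⟩, ⟨t, ht⟩⟩ := hcon
    obtain ⟨u, hu⟩ := mem_range_of_exists_le_of_exists_ge hDc ⟨s, hs⟩ ⟨t, ht⟩
    exact (key u).1 hu
  rcases hsign with hpos | hneg
  · have hccw : IsCounterclockwise F K := by
      intro t p hp
      have := (key t).2 (H p) (mem_image_of_mem _ hp)
      rw [hH] at this
      have := nonneg_of_mul_nonneg_right this (hpos t)
      simpa using this
    rw [orientationSign, if_pos hccw, harea]
    simp only [abs_of_pos (hpos _)]
    ring
  · have hccw : ¬ IsCounterclockwise F K := by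
      intro h
      have h1 := h 0 c (interior_subset hc)
      have h2 := hneg 0
      simp only [hD] at h2
      linarith
    rw [orientationSign, if_neg hccw, harea]
    simp only [abs_of_neg (hneg _), intervalIntegral.integral_neg]
    ring

theorem IsClosedConvexCurve.area_pos {F : ℝ → Plane} {L : ℝ} {K : ConvexBody Plane}
    (hF : IsClosedConvexCurve F L K) : 0 < area K :=
  ENNReal.toReal_pos (Measure.measure_pos_of_nonempty_interior _ hF.interior_nonempty).ne'
    K.isCompact.measure_ne_top


/-! ### Second-order expansion of the monodromy -/

open ComplexConjugate in
/-- Second order expansion of the monodromy of `z' = -(ε / 2) Φ' conj z` along a closed curve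
`Φ`. -/
theorem norm_monodromy_sub_le {Φ f G z : ℝ → ℂ} {L ε : ℝ} (hL : 0 ≤ L)
    (hf : ∀ t, ‖f t‖ ≤ 1) (hΦ : ∀ t, HasDerivAt Φ (f t) t) (hcl : Φ L = Φ 0)
    (hG : ∀ t, HasDerivAt G (f t * conj (Φ t)) t) (hε : 0 ≤ ε) (hε1 : ε ≤ 1)
    (hz : ∀ t, HasDerivAt z (-(ε / 2) * (f t * conj (z t))) t) :
    ‖z L - (z 0 + ε ^ 2 / 4 * (G L - G 0) * z 0)‖ ≤ Real.exp L * L ^ 3 * ‖z 0‖ * ε ^ 3 := by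
  have hcoef : ∀ t (w : ℂ), ‖-((ε : ℂ) / 2) * (f t * conj w)‖ ≤ ε * ‖w‖ := by
    intro t w
    rw [norm_mul, norm_mul, norm_neg, norm_div, RCLike.norm_conj, Complex.norm_real,
      Real.norm_of_nonneg hε, Complex.norm_ofNat]
    have h1 : ‖f t‖ * ‖w‖ ≤ ‖w‖ := mul_le_of_le_one_left (norm_nonneg w) (hf t)
    have := mul_le_mul_of_nonneg_left h1 (show 0 ≤ ε / 2 by positivity)
    have := mul_nonneg hε (norm_nonneg w)
    linarith
  have hconj : ∀ {u : ℝ → ℂ} {u' : ℂ} {t : ℝ}, HasDerivAt u u' t →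
      HasDerivAt (fun s => conj (u s)) (conj u') t := fun {u u' t} h =>
    (Complex.conjCLE.toContinuousLinearMap.hasFDerivAt.comp_hasDerivAt t h)
  have hmv : ∀ {u u' : ℝ → ℂ} {M : ℝ}, (∀ t, HasDerivAt u (u' t) t) → u 0 = 0 → 0 ≤ M →
      (∀ t ∈ Icc 0 L, ‖u' t‖ ≤ M) → ∀ t ∈ Icc 0 L, ‖u t‖ ≤ M * L := by
    intro u u' M hu hu0 hM hb t ht
    have := norm_image_sub_le_of_norm_deriv_le_segment' (fun s _ => (hu s).hasDerivWithinAt)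
      (fun s hs => hb s (Ico_subset_Icc_self hs)) t ht
    rw [hu0, sub_zero, sub_zero] at this
    exact this.trans (mul_le_mul_of_nonneg_left ht.2 hM)
  set N := ‖z 0‖
  set M := Real.exp L * N
  have hM : 0 ≤ M := by positivity
  -- Grönwall with rate 1 instead of `ε` gives a bound uniform in `ε ≤ 1`.
  have hb0 : ∀ t ∈ Icc 0 L, ‖z t‖ ≤ M := by
    intro t ht
    have h := norm_le_gronwallBound_of_norm_deriv_right_le (f := z) (δ := N) (K := 1) (ε := 0)
      (a := 0) (b := L) (fun s _ => (hz s).continuousAt.continuousWithinAt)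
      (fun s _ => (hz s).hasDerivWithinAt) le_rfl (fun s _ => by
        rw [add_zero]
        exact (hcoef s _).trans (mul_le_mul_of_nonneg_right hε1 (norm_nonneg _))) t ht
    rw [gronwallBound_ε0, one_mul, sub_zero, mul_comm] at h
    exact h.trans (mul_le_mul_of_nonneg_right (Real.exp_le_exp.2 ht.2) (norm_nonneg _))
  have hb1 : ∀ t ∈ Icc 0 L, ‖z t - z 0‖ ≤ ε * M * L :=
    hmv (fun t => (hz t).sub_const _) (sub_self _) (by positivity)
      fun t ht => (hcoef t _).trans (mul_le_mul_of_nonneg_left (hb0 t ht) hε)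
  -- `z1` and `z2` are Picard iterates: the error of each has as derivative the coefficient applied
  -- to the previous error, gaining a factor `ε L`.
  set z1 : ℝ → ℂ := fun t => z 0 - ε / 2 * ((Φ t - Φ 0) * conj (z 0)) with hz1
  have hb2 : ∀ t ∈ Icc 0 L, ‖z t - z1 t‖ ≤ ε * (ε * M * L) * L := by
    refine hmv (u' := fun t => -(ε / 2) * (f t * conj (z t - z 0))) (fun t => ?_) (by simp [hz1])
      (by positivity) fun t ht => (hcoef t _).trans (mul_le_mul_of_nonneg_left (hb1 t ht) hε)
    refine ((hz t).sub (((((hΦ t).sub_const (Φ 0)).mul_const (conj (z 0))).const_mul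
      ((ε : ℂ) / 2)).const_sub (z 0))).congr_deriv ?_
    rw [map_sub]
    ring
  set z2 : ℝ → ℂ := fun t => z 0 - ε / 2 * ((Φ t - Φ 0) * conj (z 0)) +
    ε ^ 2 / 4 * ((G t - G 0 - (Φ t - Φ 0) * conj (Φ 0)) * z 0) with hz2
  have hb3 : ∀ t ∈ Icc 0 L, ‖z t - z2 t‖ ≤ ε * (ε * (ε * M * L) * L) * L := by
    refine hmv (u' := fun t => -(ε / 2) * (f t * conj (z t - z1 t))) (fun t => ?_) (by simp [hz2])
      (by positivity) fun t ht => (hcoef t _).trans (mul_le_mul_of_nonneg_left (hb2 t ht) hε)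
    have h1 := ((((hΦ t).sub_const (Φ 0)).mul_const (conj (z 0))).const_mul
      ((ε : ℂ) / 2)).const_sub (z 0)
    have h2 := ((((hG t).sub_const (G 0)).sub (((hΦ t).sub_const (Φ 0)).mul_const
      (conj (Φ 0)))).mul_const (z 0)).const_mul ((ε : ℂ) ^ 2 / 4)
    refine ((hz t).sub (h1.add h2)).congr_deriv ?_
    simp only [hz1, map_sub, map_mul, map_div₀, Complex.conj_conj, Complex.conj_ofReal,
      map_ofNat]
    ring
  have h := hb3 L (right_mem_Icc.2 hL)
  have e : z2 L = z 0 + ε ^ 2 / 4 * (G L - G 0) * z 0 := by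
    simp only [hz2, hcl, sub_self]
    ring
  rw [e] at h
  refine h.trans_eq ?_
  simp only [M]
  ring

theorem IsFundamentalSolution.det_eq_one {F : ℝ → Plane} {ℓ : ℝ}
    {g : ℝ → Matrix (Fin 2) (Fin 2) ℝ} (hg : IsFundamentalSolution (bicycleMatrix F ℓ) g)
    (t : ℝ) : (g t).det = 1 := by
  have hd : ∀ t, HasDerivAt (fun s => (g s).det) 0 t := by
    intro t
    simp only [Matrix.det_fin_two]
    refine (((hg.1 t 0 0).mul (hg.1 t 1 1)).sub ((hg.1 t 0 1).mul (hg.1 t 1 0))).congr_deriv ?_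
    simp [bicycleMatrix, Matrix.mul_apply, Fin.sum_univ_two]
    ring
  have := is_const_of_deriv_eq_zero (fun t => (hd t).differentiableAt) (fun t => (hd t).deriv) t 0
  rw [this, hg.2, Matrix.det_one]

open ComplexConjugate in
-- The symmetric traceless matrix with first column `(x', y')` acts on `ℂ` as `w ↦ (x' + i y') conj
-- w`.
theorem IsFundamentalSolution.hasDerivAt_column {F : ℝ → Plane} {ℓ : ℝ}
    {g : ℝ → Matrix (Fin 2) (Fin 2) ℝ} (hg : IsFundamentalSolution (bicycleMatrix F ℓ) g)
    (j : Fin 2) (t : ℝ) :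
    HasDerivAt (fun s => (g s 0 j : ℂ) + g s 1 j * Complex.I)
      (-((1 / ℓ : ℝ) / 2) * ((deriv F t 0 + deriv F t 1 * Complex.I) *
        conj (g t 0 j + g t 1 j * Complex.I : ℂ))) t := by
  refine ((hg.1 t 0 j).ofReal_comp.add ((hg.1 t 1 j).ofReal_comp.mul_const Complex.I)).congr_deriv
    ?_
  simp [bicycleMatrix, Matrix.mul_apply, Fin.sum_univ_two]
  linear_combination (-(1 / (2 * ℓ : ℂ)) * (deriv F t 1 * g t 1 j)) * Complex.I_sq

/-- Second order expansion of the monodromy of the bicycle equation. -/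
theorem IsClosedConvexCurve.monodromy_expansion {F : ℝ → Plane} {L : ℝ} {K : ConvexBody Plane}
    (hF : IsClosedConvexCurve F L K) :
    ∃ C : ℝ, 0 ≤ C ∧ ∀ ℓ : ℝ, 1 ≤ ℓ → ∀ g, IsFundamentalSolution (bicycleMatrix F ℓ) g →
      |g L 0 0 - 1| ≤ C * (1 / ℓ) ^ 3 ∧
      |g L 1 0 - orientationSign F K * area K / 2 * (1 / ℓ) ^ 2| ≤ C * (1 / ℓ) ^ 3 ∧
      |g L 0 1 + orientationSign F K * area K / 2 * (1 / ℓ) ^ 2| ≤ C * (1 / ℓ) ^ 3 ∧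
      |g L 1 1 - 1| ≤ C * (1 / ℓ) ^ 3 := by
  obtain ⟨c, hc⟩ := hF.integral_cross
  set S := orientationSign F K * area K
  refine ⟨Real.exp L * L ^ 3, by have := hF.length_pos; positivity, fun ℓ hℓ g hg => ?_⟩
  have hdF : ∀ t, HasDerivAt F (deriv F t) t := fun t =>
    (hF.contDiff.differentiable one_ne_zero t).hasDerivAt
  have hdi : ∀ i t, HasDerivAt (fun s => F s i) (deriv F t i) t := fun i t =>
    ((EuclideanSpace.proj i : Plane →L[ℝ] ℝ).hasFDerivAt.comp_hasDerivAt t (hdF t))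
  have hcd : Continuous (deriv F) := hF.contDiff.continuous_deriv le_rfl
  have hcF : Continuous F := hF.contDiff.continuous
  have hx : ∀ t, HasDerivAt (fun s => F s 0 - c 0) (deriv F t 0) t := fun t =>
    (hdi 0 t).sub_const _
  have hy : ∀ t, HasDerivAt (fun s => F s 1 - c 1) (deriv F t 1) t := fun t =>
    (hdi 1 t).sub_const _
  set D : ℝ → ℝ := fun t => (F t 0 - c 0) * deriv F t 1 - (F t 1 - c 1) * deriv F t 0 with hD
  have hDc : Continuous D := by fun_prop
  have hID : ∀ t, HasDerivAt (fun u => ∫ s in 0..u, D s) (D t) t := fun t =>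
    intervalIntegral.integral_hasDerivAt_right (hDc.intervalIntegrable _ _)
      (hDc.stronglyMeasurableAtFilter _ _) hDc.continuousAt
  -- A primitive of `Φ' conj Φ`; only its imaginary part changes over a period.
  set G : ℝ → ℂ := fun t => (((F t 0 - c 0) ^ 2 / 2 + (F t 1 - c 1) ^ 2 / 2 : ℝ) : ℂ) +
    ((∫ s in 0..t, D s : ℝ) : ℂ) * Complex.I with hG
  set Φ : ℝ → ℂ := fun t => ((F t 0 - c 0 : ℝ) : ℂ) + ((F t 1 - c 1 : ℝ) : ℂ) * Complex.I with hΦ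
  set f : ℝ → ℂ := fun t => (deriv F t 0 : ℂ) + deriv F t 1 * Complex.I with hf
  have hf1 : ∀ t, ‖f t‖ ≤ 1 := fun t => by
    have := hF.unit_speed t
    rw [EuclideanSpace.norm_eq, Fin.sum_univ_two, Real.norm_eq_abs, Real.norm_eq_abs, sq_abs,
      sq_abs] at this
    rw [hf, Complex.norm_add_mul_I, this]
  have hFL : F L = F 0 := by simpa using hF.periodic 0
  have hGL : G L - G 0 = 2 * S * Complex.I := by
    simp only [hG, hFL, intervalIntegral.integral_same, hc]
    push_cast
    ring
  have key := fun j => norm_monodromy_sub_le (Φ := Φ) (f := f) (G := G) (ε := 1 / ℓ)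
    hF.length_pos.le hf1 (fun t => (hx t).ofReal_comp.add ((hy t).ofReal_comp.mul_const Complex.I))
    (by simp [hΦ, hFL])
    (fun t => by
      refine (((((hx t).pow 2).div_const 2).add (((hy t).pow 2).div_const 2)).ofReal_comp.add
        ((hID t).ofReal_comp.mul_const Complex.I)).congr_deriv ?_
      simp [hf, hΦ, hD]
      linear_combination ((deriv F t 1 : ℂ) * (F t 1 - c 1)) * Complex.I_sq)
    (by positivity) ((div_le_one (by linarith)).2 hℓ) (hg.hasDerivAt_column j)
  have hre : ∀ a b M : ℝ, ‖(a + b * Complex.I : ℂ)‖ ≤ M → |a| ≤ M ∧ |b| ≤ M := by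
    intro a b M h
    have h1 := (Complex.abs_re_le_norm _).trans h
    have h2 := (Complex.abs_im_le_norm _).trans h
    simpa using And.intro h1 h2
  have k0 := key 0
  have k1 := key 1
  have e0 : (g 0 0 0 + g 0 1 0 * Complex.I : ℂ) = 1 := by simp [hg.2]
  have e1 : (g 0 0 1 + g 0 1 1 * Complex.I : ℂ) = Complex.I := by simp [hg.2]
  rw [e0, norm_one, mul_one (Real.exp L * L ^ 3), hGL] at k0
  rw [e1, Complex.norm_I, mul_one, hGL] at k1
  have r0 := hre (g L 0 0 - 1) (g L 1 0 - S / 2 * (1 / ℓ) ^ 2) _ (by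
    refine le_of_eq_of_le (congrArg _ ?_) k0
    push_cast
    ring)
  have r1 := hre (g L 0 1 + S / 2 * (1 / ℓ) ^ 2) (g L 1 1 - 1) _ (by
    refine le_of_eq_of_le (congrArg _ ?_) k1
    push_cast
    linear_combination ((S : ℂ) / 2 * (1 / ℓ) ^ 2) * Complex.I_sq)
  exact ⟨r0.1, r0.2, r1.1, r1.2⟩


/-! ### Elliptic elements of `SL₂(ℝ)` acting on Minkowski space -/

/-- The traceless matrix with given Minkowski coordinates. -/
noncomputable def ofCoords (p q r : ℝ) : Sl2 :=
  ⟨!![p / 2, (q + r) / 2; (q - r) / 2, -(p / 2)], LinearMap.mem_ker.2 (by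
    simp [Matrix.traceLinearMap_apply, Matrix.trace_fin_two])⟩

theorem coords_ofCoords (p q r : ℝ) : coords (ofCoords p q r) = !₂[p, q, r] := by
  simp only [coords, ofCoords, Matrix.of_apply, Matrix.cons_val_zero, Matrix.cons_val_one,
    Matrix.cons_val', Matrix.cons_val_fin_one]
  congr 1
  ext i
  fin_cases i <;> simp <;> ring

theorem mink_ofCoords (p q r p' q' r' : ℝ) :
    mink (ofCoords p q r) (ofCoords p' q' r') = p * p' + q * q' - r * r' := by
  simp [mink, ofCoords, Matrix.trace_fin_two]
  ring

/-- Moving `e` past the right factor flips the sign of `u`, leaving `(C - S u)² e`: this is where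
the angle doubles. -/
theorem conj_eq_of_anticommute {R : Type*} [Ring R] [Algebra ℝ R] {u e : R} (C S : ℝ)
    (hu : u * u = -1) (hue : e * u = -(u * e)) :
    (C • 1 - S • u) * e * (C • 1 + S • u) = (C ^ 2 - S ^ 2) • e + (2 * S * C) • (-(u * e)) := by
  have h1 : e * (C • 1 + S • u) = (C • 1 - S • u) * e := by
    rw [mul_add, sub_mul, mul_smul_comm, mul_smul_comm, mul_one, smul_mul_assoc, smul_mul_assoc,
      one_mul, hue, smul_neg, sub_eq_add_neg]
  have h2 : (C • 1 - S • u) * (C • 1 - S • u) = (C ^ 2 - S ^ 2) • (1 : R) - (2 * S * C) • u := by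
    simp only [mul_sub, sub_mul, smul_mul_smul_comm, one_mul, mul_one, hu, smul_neg]
    module
  rw [mul_assoc, h1, ← mul_assoc, h2, sub_mul, smul_mul_assoc, smul_mul_assoc, one_mul, smul_neg,
    sub_eq_add_neg]

/-- Here `u = 2v` squares to `-1` and acts as a complex structure: it anticommutes with the vectors
of the orthogonal plane, on which `e ↦ -u e` is the positive quarter turn. -/
theorem isEllipticRotation_Ad {p q r φ : ℝ} (hv : p ^ 2 + q ^ 2 - r ^ 2 = -1) (hr : 0 < r)
    (hφ : Real.cos φ ≠ 1) :
    IsEllipticRotation (Ad (Real.cos (φ / 2) • (1 : Matrix (Fin 2) (Fin 2) ℝ) -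
      Real.sin (φ / 2) • !![p, q + r; q - r, -p])) (ofCoords p q r) φ := by
  set u : Matrix (Fin 2) (Fin 2) ℝ := !![p, q + r; q - r, -p] with hu
  set C := Real.cos (φ / 2)
  set S := Real.sin (φ / 2)
  have hCS : C ^ 2 + S ^ 2 = 1 := Real.cos_sq_add_sin_sq _
  have hcos : Real.cos φ = C ^ 2 - S ^ 2 := by
    rw [← Real.cos_two_mul', mul_div_cancel₀ φ two_ne_zero]
  have hsin : Real.sin φ = 2 * S * C := by
    rw [← Real.sin_two_mul, mul_div_cancel₀ φ two_ne_zero]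
  have huu : u * u = -1 := by
    ext i j
    fin_cases i <;> fin_cases j <;>
      simp [hu, Matrix.mul_apply, Fin.sum_univ_two] <;> linarith
  have hmul : (C • (1 : Matrix (Fin 2) (Fin 2) ℝ) - S • u) * (C • 1 + S • u) = 1 := by
    simp only [mul_add, sub_mul, smul_mul_smul_comm, one_mul, mul_one, huu, smul_neg]
    calc _ = (C ^ 2 + S ^ 2) • (1 : Matrix (Fin 2) (Fin 2) ℝ) := by module
      _ = 1 := by rw [hCS, one_smul]
  have hinv : (C • (1 : Matrix (Fin 2) (Fin 2) ℝ) - S • u)⁻¹ = C • 1 + S • u :=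
    Matrix.inv_eq_right_inv hmul
  have hAd : ∀ e f : Sl2, (e.1 * u = -(u * e.1)) → f.1 = -(u * e.1) →
      Ad (C • (1 : Matrix (Fin 2) (Fin 2) ℝ) - S • u) e = Real.cos φ • e + Real.sin φ • f := by
    intro e f he hf
    apply Subtype.ext
    change (C • (1 : Matrix (Fin 2) (Fin 2) ℝ) - S • u) * e.1 *
      (C • (1 : Matrix (Fin 2) (Fin 2) ℝ) - S • u)⁻¹ = Real.cos φ • e.1 + Real.sin φ • f.1
    rw [hinv, conj_eq_of_anticommute C S huu he, hcos, hsin, hf]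
  -- `(r, 0, p)` is orthogonal to `v` and has square `r² - p² = 1 + q²`; the second basis vector is
  -- `-u e₁`.
  set n := (√(1 + q ^ 2))⁻¹ with hn
  have hq : (0 : ℝ) < 1 + q ^ 2 := by positivity
  have hn0 : 0 < n := by positivity
  have hn2 : n ^ 2 * (1 + q ^ 2) = 1 := by
    rw [hn, inv_pow, Real.sq_sqrt hq.le, inv_mul_cancel₀ hq.ne']
  have h12 : (ofCoords (p * q * n) ((1 + q ^ 2) * n) (q * r * n)).1 =
      -(u * (ofCoords (r * n) 0 (p * n)).1) := by
    ext i j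
    fin_cases i <;> fin_cases j <;>
      simp [hu, ofCoords]
    · ring
    · linear_combination n / 2 * hv
    · linear_combination n / 2 * hv
    · ring
  have h1 : (ofCoords (r * n) 0 (p * n)).1 * u = -(u * (ofCoords (r * n) 0 (p * n)).1) := by
    ext i j
    fin_cases i <;> fin_cases j <;>
      simp [hu, ofCoords, Matrix.mul_apply, Fin.sum_univ_two] <;> ring
  refine ⟨?_, ?_, ?_, hφ, ofCoords (r * n) 0 (p * n),
    ofCoords (p * q * n) ((1 + q ^ 2) * n) (q * r * n), ?_, ?_, ?_, ?_, ?_, ?_, hAd _ _ h1 h12, ?_⟩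
  · rw [mink_ofCoords]; linarith
  · simpa [coords_ofCoords] using hr
  · have h2u : (ofCoords p q r).1 = (1 / 2 : ℝ) • u := by
      ext i j
      fin_cases i <;> fin_cases j <;> simp [hu, ofCoords] <;> ring
    apply Subtype.ext
    change (C • (1 : Matrix (Fin 2) (Fin 2) ℝ) - S • u) * (ofCoords p q r).1 *
      (C • (1 : Matrix (Fin 2) (Fin 2) ℝ) - S • u)⁻¹ = (ofCoords p q r).1
    have hcomm : (C • (1 : Matrix (Fin 2) (Fin 2) ℝ) - S • u) * u =
        u * (C • (1 : Matrix (Fin 2) (Fin 2) ℝ) - S • u) := by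
      simp [mul_sub, sub_mul]
    rw [h2u, mul_smul_comm, smul_mul_assoc, hcomm, hinv, mul_assoc, hmul, mul_one]
  · rw [mink_ofCoords]; linear_combination hn2 - n ^ 2 * hv
  · rw [mink_ofCoords]; linear_combination (q ^ 2 * n ^ 2) * hv + hn2
  · rw [mink_ofCoords]; ring
  · rw [mink_ofCoords]; ring
  · rw [mink_ofCoords]; linear_combination q * n * hv
  · simp only [coords_ofCoords, Matrix.det_fin_three]
    simp
    rw [← sub_pos]
    refine lt_of_lt_of_eq zero_lt_one ?_
    linear_combination n ^ 2 * hv - hn2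
  · rw [neg_smul, ← smul_neg, add_comm (Real.sin φ • _)]
    refine hAd _ (-_) ?_ ?_
    · rw [h12, neg_mul, mul_assoc, h1]
    · rw [h12, mul_neg, ← mul_assoc, huu]
      simp


/-! ### Angle and axis from the matrix entries, with error bounds -/

/-- For an elliptic `M` this is twice the sine of half of the rotation angle of `Ad M`. -/
noncomputable def rootDisc (M : Matrix (Fin 2) (Fin 2) ℝ) : ℝ := √(4 - M.trace ^ 2)

/-- The rotation angle of `Ad M` for an elliptic `M` of positive trace rotating in the sense `σ`. -/
noncomputable def ellipticAngle (σ : ℝ) (M : Matrix (Fin 2) (Fin 2) ℝ) : ℝ :=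
  σ * (2 * Real.arcsin (rootDisc M / 2))

/-- The axis of `Ad M` for an elliptic `M` rotating in the sense `σ`. -/
noncomputable def ellipticAxis (σ : ℝ) (M : Matrix (Fin 2) (Fin 2) ℝ) : Sl2 :=
  ofCoords (-σ * (M 0 0 - M 1 1) / rootDisc M) (-σ * (M 0 1 + M 1 0) / rootDisc M)
    (σ * (M 1 0 - M 0 1) / rootDisc M)

/-- By Cayley–Hamilton the traceless part of `M` squares to `-(4 - tr² M)/4`, so dividing it by `-σ
D/2` gives `u`. Positive trace puts the half angle in the range of `arcsin`; the sign `σ` makes the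
axis future pointing. -/
theorem isEllipticRotation_Ad_of_trace {M : Matrix (Fin 2) (Fin 2) ℝ} {σ : ℝ}
    (hdet : M.det = 1) (hσ : σ = 1 ∨ σ = -1) (hell : 0 < 4 - M.trace ^ 2)
    (htr : 0 < M.trace) (hpos : 0 < σ * (M 1 0 - M 0 1)) :
    IsEllipticRotation (Ad M) (ellipticAxis σ M) (ellipticAngle σ M) := by
  have hD : 0 < rootDisc M := Real.sqrt_pos.2 hell
  have hDM : rootDisc M ^ 2 = 4 - M.trace ^ 2 := Real.sq_sqrt hell.le
  rw [ellipticAxis, ellipticAngle]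
  generalize rootDisc M = D at hD hDM ⊢
  have hσ2 : σ * σ = 1 := by rcases hσ with rfl | rfl <;> norm_num
  rw [Matrix.det_fin_two] at hdet
  rw [Matrix.trace_fin_two] at hDM htr
  have hD2 : D ≤ 2 := by nlinarith
  have hs : Real.sin (Real.arcsin (D / 2)) = D / 2 :=
    Real.sin_arcsin (by linarith) (by linarith)
  have hc : Real.cos (Real.arcsin (D / 2)) = (M 0 0 + M 1 1) / 2 := by
    rw [Real.cos_arcsin, ← Real.sqrt_sq (half_pos htr).le]
    congr 1
    linear_combination -hDM / 4
  have hhalf : σ * (2 * Real.arcsin (D / 2)) / 2 = σ * Real.arcsin (D / 2) := by ring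
  have hsin : Real.sin (σ * (2 * Real.arcsin (D / 2)) / 2) = σ * (D / 2) := by
    rw [hhalf]
    rcases hσ with rfl | rfl <;> simp [hs]
  have hcos : Real.cos (σ * (2 * Real.arcsin (D / 2)) / 2) = (M 0 0 + M 1 1) / 2 := by
    rw [hhalf]
    rcases hσ with rfl | rfl <;> simp [hc]
  have hcos1 : Real.cos (σ * (2 * Real.arcsin (D / 2))) ≠ 1 := by
    have : Real.cos (σ * (2 * Real.arcsin (D / 2))) = 1 - D ^ 2 / 2 := by
      rw [← mul_div_cancel₀ (σ * (2 * Real.arcsin (D / 2))) two_ne_zero, Real.cos_two_mul, hcos]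
      linear_combination hDM / 2
    rw [this]
    have := pow_pos hD 2
    intro h
    linarith
  have hM : M = Real.cos (σ * (2 * Real.arcsin (D / 2)) / 2) • (1 : Matrix (Fin 2) (Fin 2) ℝ) -
      Real.sin (σ * (2 * Real.arcsin (D / 2)) / 2) •
        !![-σ * (M 0 0 - M 1 1) / D, -σ * (M 0 1 + M 1 0) / D + σ * (M 1 0 - M 0 1) / D;
          -σ * (M 0 1 + M 1 0) / D - σ * (M 1 0 - M 0 1) / D, -(-σ * (M 0 0 - M 1 1) / D)] := by
    rw [hsin, hcos]
    ext i j
    fin_cases i <;> fin_cases j <;> simp <;> field_simp <;> (try simp only [pow_two, hσ2]) <;> ring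
  have key := isEllipticRotation_Ad (p := -σ * (M 0 0 - M 1 1) / D)
    (q := -σ * (M 0 1 + M 1 0) / D) (r := σ * (M 1 0 - M 0 1) / D) (by
      field_simp
      linear_combination (((M 0 0 - M 1 1) ^ 2 + (M 0 1 + M 1 0) ^ 2 - (M 1 0 - M 0 1) ^ 2)) * hσ2
        + hDM - 4 * hdet) (div_pos hpos hD) hcos1
  rwa [← hM] at key

theorem two_mul_arcsin_half_sub_le {D : ℝ} (h0 : 0 ≤ D) (h1 : D ≤ 2) :
    |2 * Real.arcsin (D / 2) - D| ≤ D ^ 3 / 3 := by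
  set θ := Real.arcsin (D / 2) with hθ
  have hs : Real.sin θ = D / 2 := Real.sin_arcsin (by linarith) (by linarith)
  have hθ0 : 0 ≤ θ := Real.arcsin_nonneg.2 (by linarith)
  have hle : Real.sin θ ≤ θ := Real.sin_le hθ0
  have hj := Real.mul_le_sin hθ0 (Real.arcsin_le_pi_div_two _)
  have hθD : θ ≤ D := by
    rw [hs] at hj
    have hpi : (1 / 2 : ℝ) ≤ 2 / Real.pi := by
      rw [div_le_div_iff₀ two_pos Real.pi_pos]
      linarith [Real.pi_le_four]
    have := mul_le_mul_of_nonneg_right hpi hθ0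
    linarith
  have hcube : θ - θ ^ 3 / 6 ≤ Real.sin θ := by
    rcases hθ0.eq_or_lt with h | h
    · simp [← h]
    · exact (Real.sin_gt_sub_cube h).le
  have h3 : θ ^ 3 ≤ D ^ 3 := pow_le_pow_left₀ hθ0 hθD 3
  rw [abs_of_nonneg (by linarith)]
  linarith

/-- The trace is known only up to `O(ε³)`, too coarse against `A² ε⁴`. The determinant rewrites `4 -
(a + d)²` as `-4bc - (a - d)²`, with error `O(ε⁵)`; dividing by `D + A ε² ≥ A ε²` leaves `O(ε³)`. -/
theorem discriminant_estimate {A C ε a b c d σ : ℝ} (hA : 0 < A) (hε : 0 < ε)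
    (hε1 : ε ≤ 1) (hεK : (4 * C + 8 * C ^ 2 / A) * ε ≤ A / 2)
    (hσ : σ = 1 ∨ σ = -1) (hdet : a * d - b * c = 1)
    (ha : |a - 1| ≤ C * ε ^ 3) (hc : |c - σ * A / 2 * ε ^ 2| ≤ C * ε ^ 3)
    (hb : |b + σ * A / 2 * ε ^ 2| ≤ C * ε ^ 3) (hd : |d - 1| ≤ C * ε ^ 3) :
    0 < 4 - (a + d) ^ 2 ∧
      |√(4 - (a + d) ^ 2) - A * ε ^ 2| ≤ (4 * C + 8 * C ^ 2 / A) * ε ^ 3 := by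
  -- `K A` collects `4AC` from the cross terms and `4C²` from each of the two quadratic errors.
  set K := 4 * C + 8 * C ^ 2 / A with hK
  have hKA : K * A = 4 * A * C + 8 * C ^ 2 := by rw [hK]; field_simp
  have hσ2 : σ * σ = 1 := by rcases hσ with rfl | rfl <;> norm_num
  have hσa : |σ| = 1 := by rcases hσ with rfl | rfl <;> norm_num
  obtain ⟨γ, hγ⟩ : ∃ γ, γ = c - σ * A / 2 * ε ^ 2 := ⟨_, rfl⟩
  obtain ⟨β, hβ⟩ : ∃ β, β = b + σ * A / 2 * ε ^ 2 := ⟨_, rfl⟩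
  have hR0 : 0 ≤ C * ε ^ 3 := (abs_nonneg _).trans ha
  rw [← hγ] at hc
  rw [← hβ] at hb
  have e : 4 - (a + d) ^ 2 - (A * ε ^ 2) ^ 2 =
      2 * A * ε ^ 2 * (σ * (γ - β)) - 4 * β * γ - (a - d) ^ 2 := by
    rw [hγ, hβ]
    linear_combination -4 * hdet + A ^ 2 * ε ^ 4 * hσ2
  have hsub : |a - d| ≤ 2 * (C * ε ^ 3) := by
    have := abs_sub (a - 1) (d - 1)
    rw [sub_sub_sub_cancel_right] at this
    linarith
  have hgb : |σ * (γ - β)| ≤ 2 * (C * ε ^ 3) := by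
    rw [abs_mul, hσa, one_mul]
    have := abs_sub γ β
    linarith
  have t1 : |2 * A * ε ^ 2 * (σ * (γ - β))| ≤ 2 * A * ε ^ 2 * (2 * (C * ε ^ 3)) := by
    rw [abs_mul, abs_of_pos (by positivity : 0 < 2 * A * ε ^ 2)]
    exact mul_le_mul_of_nonneg_left hgb (by positivity)
  have t2 : |4 * β * γ| ≤ 4 * (C * ε ^ 3) ^ 2 := by
    rw [abs_mul, abs_mul, abs_of_pos (by norm_num : (0 : ℝ) < 4), mul_assoc, pow_two]
    exact mul_le_mul_of_nonneg_left (mul_le_mul hb hc (abs_nonneg _) hR0) (by norm_num)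
  have t3 : (a - d) ^ 2 ≤ 4 * (C * ε ^ 3) ^ 2 := by
    rw [← sq_abs]
    calc |a - d| ^ 2 ≤ (2 * (C * ε ^ 3)) ^ 2 := pow_le_pow_left₀ (abs_nonneg _) hsub 2
      _ = _ := by ring
  have h6 : ε ^ 6 ≤ ε ^ 5 := pow_le_pow_of_le_one hε.le hε1 (by norm_num)
  have hQ : |4 - (a + d) ^ 2 - (A * ε ^ 2) ^ 2| ≤ K * A * ε ^ 5 := by
    have hb : 2 * A * ε ^ 2 * (2 * (C * ε ^ 3)) + 8 * (C * ε ^ 3) ^ 2 ≤ K * A * ε ^ 5 := by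
      rw [hKA]
      nlinarith [mul_le_mul_of_nonneg_left h6 (sq_nonneg C)]
    rw [e]
    have h3 := sq_nonneg (a - d)
    rw [abs_le] at *
    constructor <;> linarith [t1.1, t1.2, t2.1, t2.2]
  have hpos : 0 < 4 - (a + d) ^ 2 := by
    have h1 : K * A * ε ^ 5 ≤ A / 2 * (A * ε ^ 4) := by
      have := mul_le_mul_of_nonneg_right hεK (by positivity : 0 ≤ A * ε ^ 4)
      nlinarith
    have h2 := (abs_le.1 hQ).1
    have h4 : 0 < A * (A * ε ^ 4) := by positivity
    nlinarith
  refine ⟨hpos, ?_⟩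
  set D := √(4 - (a + d) ^ 2) with hD
  have hD2 : D ^ 2 = 4 - (a + d) ^ 2 := Real.sq_sqrt hpos.le
  have hD0 : 0 < D := Real.sqrt_pos.2 hpos
  rw [← hD2, sq_sub_sq, abs_mul, abs_of_pos (by positivity)] at hQ
  have h2 : A * ε ^ 2 * |D - A * ε ^ 2| ≤ A * ε ^ 2 * (K * ε ^ 3) := by
    refine (mul_le_mul_of_nonneg_right (?_ : A * ε ^ 2 ≤ D + A * ε ^ 2) (abs_nonneg _)).trans
      (hQ.trans_eq (by ring))
    linarith
  exact le_of_mul_le_mul_left h2 (by positivity)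

theorem elliptic_estimates {M : Matrix (Fin 2) (Fin 2) ℝ} {A C ε σ : ℝ} (hA : 0 < A) (hC : 0 ≤ C)
    (hε : 0 < ε) (hε1 : ε ≤ 1) (hεK : (4 * C + 8 * C ^ 2 / A) * ε ≤ A / 2) (hεA : A * ε ≤ 1)
    (hεC : C * ε ≤ 1 / 2) (hσ : σ = 1 ∨ σ = -1) (hdet : M.det = 1)
    (h00 : |M 0 0 - 1| ≤ C * ε ^ 3) (h10 : |M 1 0 - σ * A / 2 * ε ^ 2| ≤ C * ε ^ 3)
    (h01 : |M 0 1 + σ * A / 2 * ε ^ 2| ≤ C * ε ^ 3) (h11 : |M 1 1 - 1| ≤ C * ε ^ 3) :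
    IsEllipticRotation (Ad M) (ellipticAxis σ M) (ellipticAngle σ M) ∧
    |ellipticAngle σ M - σ * (A * ε ^ 2)| ≤ (4 * C + 8 * C ^ 2 / A + 3 * A ^ 3) * ε ^ 3 ∧
    ‖coords (ellipticAxis σ M) - !₂[(0 : ℝ), 0, 1]‖ ≤
      (12 * C + 2 * (4 * C + 8 * C ^ 2 / A)) / A * ε := by
  have hdet' := hdet
  rw [Matrix.det_fin_two] at hdet'
  obtain ⟨hpos, hest⟩ := discriminant_estimate hA hε hε1 hεK hσ hdet' h00 h10 h01 h11
  rw [← Matrix.trace_fin_two] at hpos hest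
  change |rootDisc M - A * ε ^ 2| ≤ _ at hest
  have hKC : 4 * C ≤ 4 * C + 8 * C ^ 2 / A := le_add_of_nonneg_right (by positivity)
  generalize 4 * C + 8 * C ^ 2 / A = K at *
  have hσ2 : σ * σ = 1 := by rcases hσ with rfl | rfl <;> norm_num
  have hσa : |σ| = 1 := by rcases hσ with rfl | rfl <;> norm_num
  have hε2 : 0 < ε ^ 2 := by positivity
  have hK3 : K * ε ^ 3 ≤ A / 2 * ε ^ 2 := by
    have := mul_le_mul_of_nonneg_right hεK hε2.le
    linarith
  have hC3 : 4 * (C * ε ^ 3) ≤ K * ε ^ 3 := by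
    have := mul_le_mul_of_nonneg_right hKC (by positivity : 0 ≤ ε ^ 3)
    linarith
  have hAε : 0 < A * ε ^ 2 := by positivity
  -- Comparability with `A ε²`: dividing entry errors `O(ε³)` by `rootDisc M` leaves `O(ε)` for the
  -- axis.
  have hD1 : A / 2 * ε ^ 2 ≤ rootDisc M := by linarith [(abs_le.1 hest).1]
  have hD2 : rootDisc M ≤ 2 * (A * ε ^ 2) := by linarith [(abs_le.1 hest).2]
  have hD0 : 0 < rootDisc M := lt_of_lt_of_le (by positivity) hD1
  have hAε1 : A * ε ^ 2 ≤ 1 := by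
    have := mul_le_mul hεA hε1 hε.le zero_le_one
    linarith
  have hC31 : C * ε ^ 3 ≤ 1 / 2 := by
    have h1 : ε ^ 2 ≤ 1 := pow_le_one₀ hε.le hε1
    have := mul_le_mul hεC h1 hε2.le (by norm_num)
    linarith
  have htr : 0 < M.trace := by
    rw [Matrix.trace_fin_two]
    linarith [(abs_le.1 h00).1, (abs_le.1 h11).1]
  have hr : |σ * (M 1 0 - M 0 1) - A * ε ^ 2| ≤ 2 * (C * ε ^ 3) := by
    have e : σ * (M 1 0 - M 0 1) - A * ε ^ 2 =
        σ * ((M 1 0 - σ * A / 2 * ε ^ 2) - (M 0 1 + σ * A / 2 * ε ^ 2)) := by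
      linear_combination A * ε ^ 2 * hσ2
    rw [e, abs_mul, hσa, one_mul]
    exact (abs_sub _ _).trans (by linarith)
  have hp : |-σ * (M 0 0 - M 1 1)| ≤ 2 * (C * ε ^ 3) := by
    rw [abs_mul, abs_neg, hσa, one_mul, ← sub_sub_sub_cancel_right _ _ (1 : ℝ)]
    exact (abs_sub _ _).trans (by linarith)
  have hq : |-σ * (M 0 1 + M 1 0)| ≤ 2 * (C * ε ^ 3) := by
    have e : M 0 1 + M 1 0 = (M 0 1 + σ * A / 2 * ε ^ 2) + (M 1 0 - σ * A / 2 * ε ^ 2) := by ring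
    rw [abs_mul, abs_neg, hσa, one_mul, e]
    exact (abs_add_le _ _).trans (by linarith)
  refine ⟨isEllipticRotation_Ad_of_trace hdet hσ hpos htr (by linarith [(abs_le.1 hr).1]), ?_, ?_⟩
  · have h1 := two_mul_arcsin_half_sub_le hD0.le (by linarith)
    have h2 : rootDisc M ^ 3 ≤ 8 * A ^ 3 * ε ^ 3 := by
      calc rootDisc M ^ 3 ≤ (2 * (A * ε ^ 2)) ^ 3 := pow_le_pow_left₀ hD0.le hD2 3
        _ = 8 * A ^ 3 * ε ^ 6 := by ring
        _ ≤ _ := mul_le_mul_of_nonneg_left (pow_le_pow_of_le_one hε.le hε1 (by norm_num))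
          (by positivity)
    have h3 : 0 ≤ A ^ 3 * ε ^ 3 := by positivity
    rw [ellipticAngle, ← mul_sub, abs_mul, hσa, one_mul]
    have := abs_sub_le (2 * Real.arcsin (rootDisc M / 2)) (rootDisc M) (A * ε ^ 2)
    linarith
  · have hdiv : ∀ {w B : ℝ}, 0 ≤ B → |w| ≤ B * ε ^ 3 → |w / rootDisc M| ≤ 2 * B / A * ε := by
      intro w B hB hw
      rw [abs_div, abs_of_pos hD0, div_le_iff₀ hD0]
      refine hw.trans ?_
      calc B * ε ^ 3 = 2 * B / A * ε * (A / 2 * ε ^ 2) := by field_simp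
        _ ≤ _ := mul_le_mul_of_nonneg_left hD1 (by positivity)
    have k0 := hdiv (B := 2 * C) (by positivity) (hp.trans_eq (by ring))
    have k1 := hdiv (B := 2 * C) (by positivity) (hq.trans_eq (by ring))
    have k2 : |σ * (M 1 0 - M 0 1) / rootDisc M - 1| ≤ 2 * (2 * C + K) / A * ε := by
      rw [div_sub_one hD0.ne']
      refine hdiv (by linarith) ?_
      have := abs_sub_le (σ * (M 1 0 - M 0 1)) (A * ε ^ 2) (rootDisc M)
      rw [abs_sub_comm (A * ε ^ 2)] at this
      linarith
    have hnorm : ∀ x y z : ℝ, ‖(!₂[x, y, z] : EuclideanSpace ℝ (Fin 3))‖ ≤ |x| + |y| + |z| := by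
      intro x y z
      rw [EuclideanSpace.norm_eq]
      refine Real.sqrt_le_iff.2 ⟨by positivity, ?_⟩
      simp only [Fin.sum_univ_three, Real.norm_eq_abs]
      simp
      have := mul_nonneg (abs_nonneg x) (abs_nonneg y)
      have := mul_nonneg (abs_nonneg x) (abs_nonneg z)
      have := mul_nonneg (abs_nonneg y) (abs_nonneg z)
      nlinarith [sq_abs x, sq_abs y, sq_abs z]
    rw [ellipticAxis, coords_ofCoords]
    have e : ∀ x y z : ℝ, (!₂[x, y, z] - !₂[0, 0, 1] : EuclideanSpace ℝ (Fin 3)) =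
        !₂[x, y, z - 1] := by
      intro x y z
      ext i
      fin_cases i <;> simp
    rw [e]
    refine (hnorm _ _ _).trans ((add_le_add (add_le_add k0 k1) k2).trans_eq ?_)
    ring

theorem orientationSign_eq (F : ℝ → Plane) (K : ConvexBody Plane) :
    orientationSign F K = 1 ∨ orientationSign F K = -1 := by
  unfold orientationSign
  split_ifs <;> simp

end Bicycle

theorem mainTheorem2 (F : ℝ → Bicycle.Plane) (L : ℝ) (K : ConvexBody Bicycle.Plane)
    (hF : Bicycle.IsClosedConvexCurve F L K)
    (g : ℝ → ℝ → Matrix (Fin 2) (Fin 2) ℝ)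
    (hg : ∀ ℓ : ℝ, 0 < ℓ → Bicycle.IsFundamentalSolution (Bicycle.bicycleMatrix F ℓ) (g ℓ)) :
    ∃ (φ : ℝ → ℝ) (v : ℝ → Bicycle.Sl2),
      (∀ᶠ ℓ in Filter.atTop,
        Bicycle.IsEllipticRotation (Bicycle.Ad (g ℓ L)) (v ℓ) (φ ℓ)) ∧
      (fun ℓ : ℝ => φ ℓ - Bicycle.orientationSign F K * (Bicycle.area K / ℓ ^ 2))
        =O[Filter.atTop] (fun ℓ : ℝ => 1 / ℓ ^ 3) ∧
      (fun ℓ : ℝ => Bicycle.coords (v ℓ) - !₂[(0 : ℝ), 0, 1])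
        =O[Filter.atTop] (fun ℓ : ℝ => 1 / ℓ) := by
  obtain ⟨C, hC, hexp⟩ := hF.monodromy_expansion
  have hA := hF.area_pos
  have hsmall : ∀ a b : ℝ, 0 < b → ∀ᶠ ℓ : ℝ in atTop, a * (1 / ℓ) ≤ b := by
    intro a b hb
    have h : Tendsto (fun ℓ : ℝ => a * (1 / ℓ)) atTop (𝓝 (a * 0)) := by
      simpa only [one_div] using tendsto_inv_atTop_zero.const_mul a
    rw [mul_zero] at h
    exact h.eventually_le_const hb
  have key := ((((eventually_ge_atTop (1 : ℝ)).and (hsmall (4 * C + 8 * C ^ 2 / Bicycle.area K) _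
    (half_pos hA))).and (hsmall (Bicycle.area K) _ one_pos)).and
    (hsmall C _ one_half_pos)).mono fun ℓ ⟨⟨⟨h1, h2⟩, h3⟩, h4⟩ =>
      have hℓ : 0 < ℓ := zero_lt_one.trans_le h1
      have hM := hexp ℓ h1 (g ℓ) (hg ℓ hℓ)
      Bicycle.elliptic_estimates hA hC (one_div_pos.2 hℓ) ((div_le_one hℓ).2 h1) h2 h3 h4
        (Bicycle.orientationSign_eq F K) ((hg ℓ hℓ).det_eq_one L) hM.1 hM.2.1 hM.2.2.1 hM.2.2.2
  refine ⟨fun ℓ => Bicycle.ellipticAngle (Bicycle.orientationSign F K) (g ℓ L),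
    fun ℓ => Bicycle.ellipticAxis (Bicycle.orientationSign F K) (g ℓ L),
    key.mono fun ℓ h => h.1, ?_, ?_⟩
  · refine Asymptotics.IsBigO.of_bound (4 * C + 8 * C ^ 2 / Bicycle.area K +
      3 * Bicycle.area K ^ 3) ((key.and (eventually_gt_atTop 0)).mono fun ℓ h => ?_)
    have h3 : 0 < 1 / ℓ ^ 3 := by have := h.2; positivity
    have := h.1.2.1
    rw [one_div_pow, one_div_pow, mul_one_div] at this
    rwa [Real.norm_eq_abs, Real.norm_eq_abs, abs_of_pos h3]
  · refine Asymptotics.IsBigO.of_bound ((12 * C + 2 * (4 * C + 8 * C ^ 2 / Bicycle.area K)) /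
      Bicycle.area K) ((key.and (eventually_gt_atTop 0)).mono fun ℓ h => ?_)
    have h3 : 0 < 1 / ℓ := by have := h.2; positivity
    rw [Real.norm_of_nonneg h3.le]
    exact h.1.2.2
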